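/- Let $a>0$, $b\in(0,1)$ and $K>0$. There is a constant $C_2>0$, depending only on $a,b,K$, such that for every $p>0$ there are constants $c_0,C_0',C_1>0$, depending only on $a,b,K,p$, with the following property. Let $n\ge 1$ and $N$ be integers with $N\ge C_0'n$, and let $A=(a_{ji})$ be an $N\times n$ random matrix with independent real entries whose concentration functions are separated from $1$ with parameters $a,b$, that is, $$\sup_{z\in\mathbb R}P(|a_{ji}-z|<a)<b\qquad\text{for all } j\le N,\ i\le n.$$ Suppose that $$\sum_{i=1}^n\left(\mathbb E|Ae_i|^{2p}\right)^{1/p}\le K\,n\,N\,e^{c_0N/n},$$ where $|\cdot|$ is the Euclidean norm and $e_1,\dots,e_n$ is the standard basis of $\mathbb R^n$. Then the smallest singular value $\sigma_n(A)=\min_{x\in\mathbb R^n,\,|x|=1}|Ax|$ satisfies $$P\left(\sigma_n(A)\le C_1\sqrt N\right)\le e^{-C_2\min(p,1)N}.$$ -/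

import Mathlib

open MeasureTheory ProbabilityTheory
open scoped ENNReal

/-- The concentration function of the real random variable `X` is separated from 1 with parameters
`a` and `b`: the supremum over `z : ℝ` of `P (|X - z| < a)` is strictly less than `b`. -/
def BoundedConcentration {Ω : Type*} [MeasurableSpace Ω] (P : Measure Ω) (X : Ω → ℝ)
    (a b : ℝ) : Prop :=
  (⨆ z : ℝ, P {ω | |X ω - z| < a}) < ENNReal.ofReal b

/-- The smallest singular value `σ_n(A)` of an `N × n` real matrix, i.e. the minimum of the
Euclidean norm `|A x|` over the Euclidean unit sphere of `ℝⁿ` (the minimum exists for `n ≥ 1`). -/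
noncomputable def smallestSingularValue {N n : ℕ} (A : Matrix (Fin N) (Fin n) ℝ) : ℝ :=
  ⨅ x : Metric.sphere (0 : EuclideanSpace ℝ (Fin n)) 1,
    ‖Matrix.toEuclideanLin A (x : EuclideanSpace ℝ (Fin n))‖

/-- The quantity `∑ i, (E |A e_i|^{2p})^{1/p}` of a random matrix `A`, where `e_i` is the standard
basis and `|·|` the Euclidean norm. It takes the value `∞` if one of the moments is infinite. -/
noncomputable def columnMomentSum {Ω : Type*} [MeasurableSpace Ω] (P : Measure Ω) {N n : ℕ}
    (A : Ω → Matrix (Fin N) (Fin n) ℝ) (p : ℝ) : ℝ≥0∞ :=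
  ∑ i : Fin n,
    (∫⁻ ω, ENNReal.ofReal
      (‖Matrix.toEuclideanLin (A ω) (EuclideanSpace.single i 1)‖ ^ (2 * p)) ∂P) ^ (1 / p)

/-! For a fixed vector of norm at least 1/2, each coordinate of its image is an independent weighted
sum that stays away from 0 with probability bounded below. Symmetrization reduces this to Rademacher
sums. Multiplying Laplace transforms over the rows makes the image shorter than a constant times √N
only with probability e^{-γN}, γ = (1 - b)/288 (`measure_norm_toEuclideanLin_le`).

The operator norm is not controlled, so a standard net argument fails. Instead a unit vector is
rounded to a grid whose mesh in direction i is inversely proportional to max(1, |Ae_i|/√T), up to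
constants. Rounding each coordinate up or down so that the errors in the image do not add up keeps
the image error below √T (`exists_lattice_rounding`, `exists_gridPoint_near`). The grid is random,
but the cost of a union bound over all possible grids depends only on the product of the max(1,
|Ae_i|²/T) (`measure_exists_grid_le`).

That product exceeds e^{γN/4} with exponentially small probability, by independence of the columns,
Markov's inequality for its p-th power and the moment hypothesis (`measure_lt_prod_max_le`).
Otherwise the union bound costs e^{γN/4} times a fixed power of e^n, which e^{-γN} absorbs once N/n
is large. -/

/-! ### Anti-concentration of Rademacher sums. -/

/-- The real sign `1` or `-1` encoded by a Boolean. -/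
def boolSign (e : Bool) : ℝ := if e then 1 else -1

/-- Up to the factor 2^n, this is the characteristic function of a Rademacher sum, which factors by
independence. -/
lemma sum_cos_signed_sum (n : ℕ) (w : Fin n → ℝ) :
    ∑ e : Fin n → Bool, Real.cos (∑ i, boolSign (e i) * w i) = ∏ i, (2 * Real.cos (w i)) := by
  have h : ∑ e : Fin n → Bool, Complex.exp ((∑ i, boolSign (e i) * w i : ℝ) * Complex.I)
      = ((∏ i, (2 * Real.cos (w i)) : ℝ) : ℂ) := by
    have h1 : ∀ i, ((2 * Real.cos (w i) : ℝ) : ℂ)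
        = ∑ b : Bool, Complex.exp ((boolSign b * w i : ℝ) * Complex.I) := by
      intro i
      push_cast
      rw [Complex.two_cos]
      simp [boolSign]
    rw [Complex.ofReal_prod, Finset.prod_congr rfl (fun i _ => h1 i), Fintype.prod_sum]
    refine Finset.sum_congr rfl fun e _ => ?_
    rw [← Complex.exp_sum, ← Finset.sum_mul]
    push_cast
    rfl
  have h2 := congrArg Complex.re h
  rw [Complex.ofReal_re, Complex.re_sum] at h2
  simpa only [Complex.exp_ofReal_mul_I_re] using h2

/-- A Rademacher sum is at least a third of its standard deviation with probability at
least `1 / 18`. -/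
lemma card_signed_sum_ge (n : ℕ) (w : Fin n → ℝ) (r : ℝ) (hr : 0 < r)
    (hw : ∑ i, w i ^ 2 = r ^ 2) :
    (2 : ℝ) ^ n / 18 ≤
      ((Finset.univ.filter fun e : Fin n → Bool => r / 3 ≤ |∑ i, boolSign (e i) * w i|).card : ℝ) := by
  classical
  set F := Finset.univ.filter fun e : Fin n → Bool => r / 3 ≤ |∑ i, boolSign (e i) * w i|
  -- The average of cos(S/r) is the product of the cos(w i / r), at most e^{-1/5} ≤ 5/6. The rate
  -- 1/5 comes from 2/π² ≥ 1/5.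
  have hcos : ∑ e : Fin n → Bool, Real.cos ((∑ i, boolSign (e i) * w i) / r)
      ≤ 2 ^ n * (5 / 6) := by
    have := sum_cos_signed_sum n (fun i => w i / r)
    have h1 : ∀ e : Fin n → Bool, (∑ i, boolSign (e i) * w i) / r
        = ∑ i, boolSign (e i) * (w i / r) := by
      intro e; rw [Finset.sum_div]; simp [mul_div_assoc]
    simp_rw [h1, this, Finset.prod_mul_distrib]
    simp only [Finset.prod_const, Finset.card_univ, Fintype.card_fin]
    gcongr
    have hle : ∀ i, |w i / r| ≤ 1 := by
      intro i
      have : w i ^ 2 ≤ r ^ 2 := by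
        rw [← hw]; exact Finset.single_le_sum (f := fun i => w i ^ 2)
          (fun i _ => sq_nonneg _) (Finset.mem_univ i)
      rw [abs_div, abs_of_pos hr, div_le_one hr]
      exact abs_le_of_sq_le_sq this hr.le
    have h5 : ∀ i, Real.cos (w i / r) ≤ Real.exp (-(1 / 5) * (w i / r) ^ 2) := by
      intro i
      have hpi : |w i / r| ≤ Real.pi := (hle i).trans (by linarith [Real.pi_gt_three])
      have h6 := Real.cos_le_one_sub_mul_cos_sq hpi
      have h7 : (1 : ℝ) / 5 ≤ 2 / Real.pi ^ 2 := by
        rw [div_le_div_iff₀ (by norm_num) (by positivity)]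
        nlinarith [Real.pi_lt_d2, Real.pi_pos]
      have h8 := Real.add_one_le_exp (-(1 / 5) * (w i / r) ^ 2)
      nlinarith [mul_le_mul_of_nonneg_right h7 (sq_nonneg (w i / r))]
    calc ∏ i, Real.cos (w i / r) ≤ ∏ i, Real.exp (-(1 / 5) * (w i / r) ^ 2) := by
          refine Finset.prod_le_prod (fun i _ => ?_) (fun i _ => h5 i)
          apply Real.cos_nonneg_of_neg_pi_div_two_le_of_le <;>
            linarith [abs_le.1 (hle i), (abs_le.1 (hle i)).1, (abs_le.1 (hle i)).2,
              Real.pi_gt_three]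
      _ = Real.exp (-(1 / 5)) := by
          rw [← Real.exp_sum, ← Finset.mul_sum]
          simp_rw [div_pow]
          rw [← Finset.sum_div, hw, div_self (by positivity), mul_one]
      _ ≤ 5 / 6 := by
          rw [Real.exp_neg, inv_le_comm₀ (Real.exp_pos _) (by norm_num)]
          have := Real.add_one_le_exp (1 / 5 : ℝ)
          linarith
  -- Off `F`, cos ≥ 1 - (1/3)²/2 = 17/18; on `F`, cos ≥ -1. Averaging gives 17/18 - 2|F|/2^n ≤ 5/6,
  -- hence the proportion 1/18.
  have hpt : ∀ e : Fin n → Bool, 17 / 18 - 2 * (if e ∈ F then 1 else 0)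
      ≤ Real.cos ((∑ i, boolSign (e i) * w i) / r) := by
    intro e
    by_cases he : e ∈ F
    · simp only [he, if_true]
      linarith [Real.neg_one_le_cos ((∑ i, boolSign (e i) * w i) / r)]
    · simp only [he, if_false]
      have h1 : |∑ i, boolSign (e i) * w i| < r / 3 := by
        simpa [F] using he
      have h2 : |(∑ i, boolSign (e i) * w i) / r| ≤ 1 / 3 := by
        rw [abs_div, abs_of_pos hr, div_le_iff₀ hr]; linarith
      have h3 := Real.one_sub_sq_div_two_le_cos (x := (∑ i, boolSign (e i) * w i) / r)
      have h4 : ((∑ i, boolSign (e i) * w i) / r) ^ 2 ≤ (1 / 3) ^ 2 := sq_le_sq' (abs_le.1 h2).1 (abs_le.1 h2).2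
      linarith
  have hsum := (Finset.sum_le_sum fun e (_ : e ∈ Finset.univ) => hpt e).trans hcos
  rw [Finset.sum_sub_distrib, ← Finset.mul_sum] at hsum
  simp at hsum
  have : (Finset.univ.filter fun e => e ∈ F) = F := by ext; simp
  linarith

/-! ### Anti-concentration of weighted sums by symmetrization. -/

lemma prod_abs_sub_lt_le (μ : Measure ℝ) [IsProbabilityMeasure μ] {a : ℝ} {q : ℝ≥0∞}
    (h : ∀ z, μ {u | |u - z| < a} ≤ q) :
    (μ.prod μ) {p : ℝ × ℝ | |p.1 - p.2| < a} ≤ q := by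
  rw [Measure.prod_apply (measurableSet_lt (by fun_prop) (by fun_prop))]
  calc ∫⁻ x, μ (Prod.mk x ⁻¹' {p : ℝ × ℝ | |p.1 - p.2| < a}) ∂μ
      ≤ ∫⁻ _, q ∂μ := by
        refine lintegral_mono fun x => ?_
        have : Prod.mk x ⁻¹' {p : ℝ × ℝ | |p.1 - p.2| < a} = {u | |u - x| < a} := by
          ext u; simp [abs_sub_comm]
        rw [this]; exact h x
    _ = q := by simp

section SymmetrizedSum

variable {n : ℕ} (μ : Fin n → Measure ℝ) [∀ i, IsProbabilityMeasure (μ i)] (y : Fin n → ℝ)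

/-- If the sum of squares is small, the indices with difference below `a` carry more than (1 + b)/2
of the total weight `Y`. Their expected weight is at most b·Y, so Markov's inequality applies. -/
lemma pi_prod_sum_sq_lt_le {a b : ℝ} (ha : 0 < a) (hb0 : 0 < b)
    (h : ∀ i z, μ i {u | |u - z| < a} ≤ ENNReal.ofReal b) (hy : 0 < ∑ i, y i ^ 2) :
    Measure.pi (fun i => (μ i).prod (μ i))
      {w | ∑ i, (y i * ((w i).1 - (w i).2)) ^ 2 < a ^ 2 * ((1 - b) / 2) * ∑ i, y i ^ 2}
      ≤ ENNReal.ofReal ((1 + b) / 2) := by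
  set ν := Measure.pi (fun i => (μ i).prod (μ i))
  set Y := ∑ i, y i ^ 2
  set B : Fin n → Set (Fin n → ℝ × ℝ) := fun i => {w | |(w i).1 - (w i).2| < a}
  have hB : ∀ i, MeasurableSet (B i) := fun i => measurableSet_lt (by fun_prop) (by fun_prop)
  have hνB : ∀ i, ν (B i) ≤ ENNReal.ofReal b := by
    intro i
    have := (measurePreserving_eval (fun i => (μ i).prod (μ i)) i).measure_preimage
      (s := {p : ℝ × ℝ | |p.1 - p.2| < a})
      (measurableSet_lt (by fun_prop) (by fun_prop)).nullMeasurableSet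
    exact (le_of_eq this).trans (prod_abs_sub_lt_le (μ i) (h i))
  set f : (Fin n → ℝ × ℝ) → ℝ≥0∞ := fun w =>
    ∑ i, ENNReal.ofReal (y i ^ 2) * (B i).indicator 1 w
  have hfint : ∫⁻ w, f w ∂ν ≤ ENNReal.ofReal (b * Y) := by
    rw [lintegral_finsetSum (f := fun i w => ENNReal.ofReal (y i ^ 2) * (B i).indicator 1 w) _
      fun i _ => (measurable_const.mul (measurable_one.indicator (hB i)))]
    simp_rw [lintegral_const_mul _ (measurable_one.indicator (hB _)), lintegral_indicator_one (hB _)]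
    rw [mul_comm b, ENNReal.ofReal_mul hy.le, ENNReal.ofReal_sum_of_nonneg
      fun i _ => sq_nonneg _, Finset.sum_mul]
    exact Finset.sum_le_sum fun i _ => by gcongr; exact hνB i
  have hsub : {w : Fin n → ℝ × ℝ | ∑ i, (y i * ((w i).1 - (w i).2)) ^ 2
      < a ^ 2 * ((1 - b) / 2) * Y} ⊆ {w | ENNReal.ofReal ((1 + b) / 2 * Y) ≤ f w} := by
    intro w hw
    simp only [Set.mem_ofPred_eq] at hw ⊢
    have hf : f w = ENNReal.ofReal (∑ i, y i ^ 2 * (B i).indicator 1 w) := by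
      rw [ENNReal.ofReal_sum_of_nonneg]
      · refine Finset.sum_congr rfl fun i _ => ?_
        rw [ENNReal.ofReal_mul (sq_nonneg _)]
        by_cases hi : w ∈ B i <;> simp [hi]
      · intro i _
        exact mul_nonneg (sq_nonneg _) (Set.indicator_nonneg (by simp) _)
    rw [hf]
    apply ENNReal.ofReal_le_ofReal
    have hterm : ∀ i, a ^ 2 * (y i ^ 2 - y i ^ 2 * (B i).indicator 1 w)
        ≤ (y i * ((w i).1 - (w i).2)) ^ 2 := by
      intro i
      by_cases hi : w ∈ B i
      · simp [hi]; positivity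
      · have h1 : a ≤ |(w i).1 - (w i).2| := by simpa [B] using hi
        have h2 : a ^ 2 ≤ ((w i).1 - (w i).2) ^ 2 := by
          rw [← sq_abs ((w i).1 - (w i).2)]; gcongr
        simp [hi]
        nlinarith [mul_le_mul_of_nonneg_left h2 (sq_nonneg (y i))]
    have hs := Finset.sum_le_sum fun i (_ : i ∈ Finset.univ) => hterm i
    rw [← Finset.mul_sum, Finset.sum_sub_distrib] at hs
    have h3 : a ^ 2 * (Y - ∑ i, y i ^ 2 * (B i).indicator 1 w) < a ^ 2 * ((1 - b) / 2 * Y) := by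
      rw [← mul_assoc]; exact hs.trans_lt hw
    have h4 := lt_of_mul_lt_mul_left h3 (sq_nonneg a)
    linarith
  refine (measure_mono hsub).trans ?_
  have hpos : 0 < (1 + b) / 2 * Y := by positivity
  have hmk := (mul_meas_ge_le_lintegral₀ (μ := ν) (f := f)
    (Finset.measurable_sum _ fun i _ =>
      (measurable_const.mul (measurable_one.indicator (hB i)))).aemeasurable
    (ENNReal.ofReal ((1 + b) / 2 * Y))).trans hfint
  -- Markov gives the ratio 2b/(1 + b), which is at most (1 + b)/2 because (1 - b)² ≥ 0.
  have hle : ENNReal.ofReal (b * Y)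
      ≤ ENNReal.ofReal ((1 + b) / 2 * Y) * ENNReal.ofReal ((1 + b) / 2) := by
    rw [← ENNReal.ofReal_mul hpos.le]
    apply ENNReal.ofReal_le_ofReal
    nlinarith [mul_nonneg (sq_nonneg (1 - b)) hy.le]
  exact (ENNReal.mul_le_mul_iff_right (by simpa using hpos) ENNReal.ofReal_ne_top).1 (hmk.trans hle)

/-- Swapping the two i.i.d. entries of a pair preserves the law and flips the sign of their
difference. -/
lemma measure_signed_sum_eq (e : Fin n → Bool) (t : ℝ) :
    Measure.pi (fun i => (μ i).prod (μ i))
      {w | t ≤ |∑ i, boolSign (e i) * (y i * ((w i).1 - (w i).2))|} =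
    Measure.pi (fun i => (μ i).prod (μ i)) {w | t ≤ |∑ i, y i * ((w i).1 - (w i).2)|} := by
  have hmp := measurePreserving_pi (fun i => (μ i).prod (μ i)) (fun i => (μ i).prod (μ i))
    (f := fun i p => if e i then p else p.swap) (by
      intro i
      by_cases hi : e i
      · simp only [hi, if_true]
        exact MeasurePreserving.id _
      · simpa [hi] using Measure.measurePreserving_swap)
  rw [← hmp.measure_preimage (measurableSet_le (by fun_prop) (by fun_prop)).nullMeasurableSet]
  congr 1
  ext w
  simp only [Set.mem_ofPred_eq, Set.mem_preimage]
  have : ∀ i, boolSign (e i) *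
      (y i * ((if e i then w i else (w i).swap).1 - (if e i then w i else (w i).swap).2))
      = y i * ((w i).1 - (w i).2) := by
    intro i
    by_cases hi : e i
    · simp [hi, boolSign]
    · simp [hi, boolSign]
      ring
  rw [Finset.sum_congr rfl fun i _ => this i]

/-- By sign invariance, the probability on the right can be averaged over all sign patterns. For
each fixed `w` on the left, at least 1/18 of the patterns give a large signed sum. -/
lemma measure_abs_symmetrized_sum_ge {R : ℝ} (hR : 0 < R) :
    Measure.pi (fun i => (μ i).prod (μ i)) {w | R ^ 2 ≤ ∑ i, (y i * ((w i).1 - (w i).2)) ^ 2}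
    ≤ 18 * Measure.pi (fun i => (μ i).prod (μ i)) {w | R / 3 ≤ |∑ i, y i * ((w i).1 - (w i).2)|} := by
  classical
  set ν := Measure.pi (fun i => (μ i).prod (μ i))
  set E : (Fin n → Bool) → Set (Fin n → ℝ × ℝ) := fun e =>
    {w | R / 3 ≤ |∑ i, boolSign (e i) * (y i * ((w i).1 - (w i).2))|}
  set G : Set (Fin n → ℝ × ℝ) := {w | R ^ 2 ≤ ∑ i, (y i * ((w i).1 - (w i).2)) ^ 2}
  have hE : ∀ e, MeasurableSet (E e) := fun e => measurableSet_le (by fun_prop) (by fun_prop)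
  have hG : MeasurableSet G := measurableSet_le (by fun_prop) (by fun_prop)
  have h1 : ∑ e, ν (E e) = 2 ^ n * ν {w | R / 3 ≤ |∑ i, y i * ((w i).1 - (w i).2)|} := by
    simp only [E, ν, measure_signed_sum_eq]
    simp
  have h2 : (2 : ℝ≥0∞) ^ n * ν G ≤ 18 * ∑ e, ν (E e) := by
    calc (2 : ℝ≥0∞) ^ n * ν G = ∫⁻ w, 2 ^ n * G.indicator 1 w ∂ν := by
          rw [lintegral_const_mul _ (measurable_one.indicator hG), lintegral_indicator_one hG]
      _ ≤ ∫⁻ w, 18 * ∑ e, (E e).indicator 1 w ∂ν := by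
          refine lintegral_mono fun w => ?_
          by_cases hw : w ∈ G
          · simp only [hw, Set.indicator_of_mem, Pi.one_apply, mul_one]
            have hS : 0 ≤ ∑ i, (y i * ((w i).1 - (w i).2)) ^ 2 :=
              Finset.sum_nonneg fun i _ => sq_nonneg _
            set r := Real.sqrt (∑ i, (y i * ((w i).1 - (w i).2)) ^ 2)
            have hRr : R ≤ r := Real.le_sqrt_of_sq_le hw
            have hc := card_signed_sum_ge n (fun i => y i * ((w i).1 - (w i).2)) r
              (hR.trans_le hRr) (Real.sq_sqrt hS).symm
            set F := Finset.univ.filter fun e : Fin n → Bool =>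
              r / 3 ≤ |∑ i, boolSign (e i) * (y i * ((w i).1 - (w i).2))|
            have hF : (F.card : ℝ≥0∞) ≤ ∑ e, (E e).indicator 1 w := by
              calc (F.card : ℝ≥0∞) = ∑ e ∈ F, 1 := by simp
                _ ≤ ∑ e ∈ F, (E e).indicator 1 w := by
                    refine Finset.sum_le_sum fun e he => ?_
                    have : w ∈ E e := by
                      have h3 := (Finset.mem_filter.1 he).2
                      have : R / 3 ≤ r / 3 := by linarith
                      exact this.trans h3
                    simp [this]
                _ ≤ _ := Finset.sum_le_sum_of_subset (Finset.subset_univ _)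
            have h4 : (2 : ℝ≥0∞) ^ n ≤ 18 * F.card := by
              have : (2 : ℕ) ^ n ≤ 18 * F.card := by
                have : (2 : ℝ) ^ n ≤ 18 * F.card := by linarith
                exact_mod_cast this
              exact_mod_cast this
            exact h4.trans (by gcongr)
          · simp [hw]
      _ = 18 * ∑ e, ν (E e) := by
          rw [lintegral_const_mul _ (Finset.measurable_sum _ fun e _ =>
            measurable_one.indicator (hE e)), lintegral_finsetSum _ fun e _ =>
            measurable_one.indicator (hE e)]
          simp_rw [lintegral_indicator_one (hE _)]
  rw [h1, mul_left_comm] at h2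
  exact (ENNReal.mul_le_mul_iff_right (by simp) (by simp)).1 h2

/-- Anti-concentration at the origin of a weighted sum, in terms of the product of the laws of
the summands. -/
lemma pi_abs_sum_ge {a b : ℝ} (ha : 0 < a) (hb0 : 0 < b) (hb1 : b < 1)
    (h : ∀ i z, μ i {u | |u - z| < a} ≤ ENNReal.ofReal b) (hy : 1 / 4 ≤ ∑ i, y i ^ 2) :
    ENNReal.ofReal ((1 - b) / 72) ≤
      Measure.pi μ {v | a * Real.sqrt ((1 - b) / 8) / 6 ≤ |∑ i, y i * v i|} := by
  set ν := Measure.pi (fun i => (μ i).prod (μ i))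
  set R := a * Real.sqrt ((1 - b) / 8)
  have hR : 0 < R := mul_pos ha (Real.sqrt_pos.2 (by linarith))
  have hR2 : R ^ 2 = a ^ 2 * ((1 - b) / 8) := by
    rw [mul_pow, Real.sq_sqrt (by linarith)]
  set T : Set (Fin n → ℝ) := {v | R / 6 ≤ |∑ i, y i * v i|}
  have hT : MeasurableSet T := measurableSet_le (by fun_prop) (by fun_prop)
  have hfst := measurePreserving_pi (fun i => (μ i).prod (μ i)) μ (f := fun i p => p.1)
    (fun i => measurePreserving_fst)
  have hsnd := measurePreserving_pi (fun i => (μ i).prod (μ i)) μ (f := fun i p => p.2)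
    (fun i => measurePreserving_snd)
  -- If the difference of two copies is at least R/3, one copy is at least R/6, whence the factor 2.
  have h1 : ν {w | R / 3 ≤ |∑ i, y i * ((w i).1 - (w i).2)|} ≤ 2 * Measure.pi μ T := by
    rw [two_mul]
    nth_rewrite 1 [← hfst.measure_preimage hT.nullMeasurableSet]
    rw [← hsnd.measure_preimage hT.nullMeasurableSet]
    refine (measure_mono ?_).trans (measure_union_le _ _)
    intro w hw
    simp only [Set.mem_ofPred_eq, Set.mem_union, Set.mem_preimage, T] at hw ⊢
    by_contra! hcon
    have h2 : ∑ i, y i * ((w i).1 - (w i).2) = ∑ i, y i * (w i).1 - ∑ i, y i * (w i).2 := by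
      rw [← Finset.sum_sub_distrib]; simp [mul_sub]
    rw [h2] at hw
    linarith [abs_sub (∑ i, y i * (w i).1) (∑ i, y i * (w i).2), hcon.1, hcon.2]
  have h2 := measure_abs_symmetrized_sum_ge μ y hR
  have h3 := pi_prod_sum_sq_lt_le μ y ha hb0 h (by linarith)
  set G : Set (Fin n → ℝ × ℝ) := {w | R ^ 2 ≤ ∑ i, (y i * ((w i).1 - (w i).2)) ^ 2}
  have hG : MeasurableSet G := measurableSet_le (by fun_prop) (by fun_prop)
  have h4 : ν Gᶜ ≤ ENNReal.ofReal ((1 + b) / 2) := by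
    refine (measure_mono ?_).trans h3
    intro w hw
    simp only [G, Set.mem_compl_iff, Set.mem_ofPred_eq, not_le] at hw ⊢
    refine hw.trans_le ?_
    rw [hR2]
    nlinarith [mul_nonneg (mul_nonneg (sq_nonneg a) (by linarith : 0 ≤ 1 - b))
      (by linarith : 0 ≤ ∑ i, y i ^ 2 - 1 / 4)]
  have h5 : ENNReal.ofReal ((1 - b) / 2) ≤ ν G := by
    have h6 : 1 ≤ ν G + ν Gᶜ := by rw [measure_add_measure_compl hG]; simp
    have h7 : ENNReal.ofReal ((1 - b) / 2) + ENNReal.ofReal ((1 + b) / 2) = 1 := by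
      rw [← ENNReal.ofReal_add (by linarith) (by linarith)]
      ring_nf; simp
    have h8 := h6.trans (add_le_add_right h4 (ν G))
    rw [← h7] at h8
    exact (ENNReal.add_le_add_iff_right ENNReal.ofReal_ne_top).1 h8
  have h6 : 36 * ENNReal.ofReal ((1 - b) / 72) ≤ 36 * Measure.pi μ T := by
    calc 36 * ENNReal.ofReal ((1 - b) / 72) = ENNReal.ofReal ((1 - b) / 2) := by
          rw [show (36 : ℝ≥0∞) = ENNReal.ofReal 36 by simp, ← ENNReal.ofReal_mul (by norm_num)]
          ring_nf
      _ ≤ 18 * (2 * Measure.pi μ T) := h5.trans (h2.trans (by gcongr))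
      _ = 36 * Measure.pi μ T := by rw [← mul_assoc]; norm_num
  exact (ENNReal.mul_le_mul_iff_right (by simp) (by simp)).1 h6

end SymmetrizedSum

/-! ### Independence of rows and columns, and the small ball estimate. -/

lemma ProbabilityTheory.iIndepFun.curry {Ω ι κ : Type*} [MeasurableSpace Ω] {P : Measure Ω}
    {X : ι → κ → Ω → ℝ} (mX : ∀ i j, Measurable (X i j))
    (h : iIndepFun (fun (p : ι × κ) ω => X p.1 p.2 ω) P) :
    iIndepFun (fun i ω j => X i j ω) P := by
  have := h.isProbabilityMeasure
  have : ∀ i j, IsProbabilityMeasure (P.map (X i j)) :=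
    fun i j => Measure.isProbabilityMeasure_map (mX i j).aemeasurable
  have hrow : ∀ i, iIndepFun (X i) P := fun i =>
    h.precomp (g := fun j => (i, j)) fun _ _ hj => (Prod.mk.inj hj).2
  rw [iIndepFun_iff_map_fun_eq_infinitePi_map (by fun_prop)]
  have h1 := h.map_fun_eq_infinitePi_map fun p : ι × κ => mX p.1 p.2
  have h2 := Measure.infinitePi_map_curry (fun i j => P.map (X i j))
  rw [← h1, Measure.map_map (by fun_prop) (by fun_prop)] at h2
  refine Eq.trans h2 ?_
  congr 1
  funext i
  exact ((hrow i).map_fun_eq_infinitePi_map (mX i)).symm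

lemma norm_toEuclideanLin_sq {N n : ℕ} (A : Matrix (Fin N) (Fin n) ℝ)
    (y : EuclideanSpace ℝ (Fin n)) :
    ‖Matrix.toEuclideanLin A y‖ ^ 2 = ∑ j, (∑ i, y i * A j i) ^ 2 := by
  rw [EuclideanSpace.norm_sq_eq]
  refine Finset.sum_congr rfl fun j _ => ?_
  rw [Real.norm_eq_abs, sq_abs]
  congr 1
  simp [Matrix.toLpLin_apply, Matrix.mulVec, dotProduct, mul_comm]

section RandomMatrix

variable {Ω : Type*} [MeasurableSpace Ω] {P : Measure Ω} [IsProbabilityMeasure P]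

lemma measure_abs_sum_ge {n : ℕ} {X : Fin n → Ω → ℝ} (mX : ∀ i, Measurable (X i))
    (hX : iIndepFun X P) {a b : ℝ} (ha : 0 < a) (hb0 : 0 < b) (hb1 : b < 1)
    (h : ∀ i, BoundedConcentration P (X i) a b) (y : Fin n → ℝ) (hy : 1 / 4 ≤ ∑ i, y i ^ 2) :
    ENNReal.ofReal ((1 - b) / 72) ≤
      P {ω | a * Real.sqrt ((1 - b) / 8) / 6 ≤ |∑ i, y i * X i ω|} := by
  have : ∀ i, IsProbabilityMeasure (P.map (X i)) :=
    fun i => Measure.isProbabilityMeasure_map (mX i).aemeasurable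
  have h1 := pi_abs_sum_ge (fun i => P.map (X i)) y ha hb0 hb1 (fun i z => by
    rw [Measure.map_apply (mX i) (measurableSet_lt (by fun_prop) (by fun_prop))]
    exact (le_iSup (fun z => P {ω | |X i ω - z| < a}) z).trans (h i).le) hy
  rw [← (iIndepFun_iff_map_fun_eq_pi_map fun i => (mX i).aemeasurable).1 hX,
    Measure.map_apply (by fun_prop) (measurableSet_le (by fun_prop) (by fun_prop))] at h1
  exact h1

/-- The exponential is at most 1/2 on the event and at most 1 off it. This form is used because it
multiplies over independent rows. -/
lemma lintegral_exp_neg_sq_le {S : Ω → ℝ} (mS : Measurable S) {c η : ℝ} (hc : 0 < c)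
    (hη : 0 ≤ η) (h : ENNReal.ofReal η ≤ P {ω | c ≤ |S ω|}) :
    ∫⁻ ω, ENNReal.ofReal (Real.exp (-(S ω ^ 2 / c ^ 2))) ∂P ≤ ENNReal.ofReal (1 - η / 2) := by
  have hE : MeasurableSet {ω | c ≤ |S ω|} := measurableSet_le (by fun_prop) (by fun_prop)
  have hm : Measurable fun ω => ENNReal.ofReal (Real.exp (-(S ω ^ 2 / c ^ 2))) := by fun_prop
  have h1 : ∫⁻ ω, ENNReal.ofReal (Real.exp (-(S ω ^ 2 / c ^ 2))) ∂P + ENNReal.ofReal (η / 2) ≤ 1 := by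
    calc ∫⁻ ω, ENNReal.ofReal (Real.exp (-(S ω ^ 2 / c ^ 2))) ∂P + ENNReal.ofReal (η / 2)
        ≤ ∫⁻ ω, ENNReal.ofReal (Real.exp (-(S ω ^ 2 / c ^ 2))) ∂P
          + ENNReal.ofReal (1 / 2) * P {ω | c ≤ |S ω|} := by
          rw [show η / 2 = 1 / 2 * η by ring, ENNReal.ofReal_mul (by norm_num)]
          gcongr
      _ = ∫⁻ ω, (ENNReal.ofReal (Real.exp (-(S ω ^ 2 / c ^ 2)))
          + ENNReal.ofReal (1 / 2) * {ω | c ≤ |S ω|}.indicator 1 ω) ∂P := by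
          rw [lintegral_add_left hm, lintegral_const_mul _ (measurable_one.indicator hE),
            lintegral_indicator_one hE]
      _ ≤ ∫⁻ _, 1 ∂P := by
          refine lintegral_mono fun ω => ?_
          by_cases hω : c ≤ |S ω|
          · have h2 : c ^ 2 ≤ S ω ^ 2 := by rw [← sq_abs (S ω)]; gcongr
            have h3 : 1 ≤ S ω ^ 2 / c ^ 2 := (one_le_div (by positivity)).2 h2
            have h4 : Real.exp (-(S ω ^ 2 / c ^ 2)) ≤ 1 / 2 := by
              rw [Real.exp_neg, one_div]
              apply inv_anti₀ (by norm_num)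
              linarith [Real.add_one_le_exp (S ω ^ 2 / c ^ 2)]
            simp only [Set.indicator_of_mem (show ω ∈ {ω | c ≤ |S ω|} from hω), Pi.one_apply,
              mul_one]
            rw [← ENNReal.ofReal_add (Real.exp_pos _).le (by norm_num), ENNReal.ofReal_le_one]
            linarith
          · simp only [Set.indicator_of_notMem (show ω ∉ {ω | c ≤ |S ω|} from hω), mul_zero,
              add_zero]
            rw [ENNReal.ofReal_le_one, Real.exp_le_one_iff, neg_nonpos]
            positivity
      _ = 1 := by simp
  rw [ENNReal.ofReal_sub _ (by linarith), ENNReal.ofReal_one]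
  exact ENNReal.le_sub_of_add_le_right ENNReal.ofReal_ne_top h1

/-- Small ball estimate for the image of a fixed vector. -/
lemma measure_norm_toEuclideanLin_le {N n : ℕ} {A : Ω → Matrix (Fin N) (Fin n) ℝ}
    (mA : ∀ j i, Measurable (fun ω => A ω j i))
    (hA : iIndepFun (fun (ji : Fin N × Fin n) (ω : Ω) => A ω ji.1 ji.2) P)
    {a b : ℝ} (ha : 0 < a) (hb0 : 0 < b) (hb1 : b < 1)
    (h : ∀ j i, BoundedConcentration P (fun ω => A ω j i) a b)
    (y : EuclideanSpace ℝ (Fin n)) (hy : 1 / 2 ≤ ‖y‖) :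
    P {ω | ‖Matrix.toEuclideanLin (A ω) y‖ ≤
        a * Real.sqrt ((1 - b) / 8) / 6 * Real.sqrt ((1 - b) / 288) * Real.sqrt N}
      ≤ ENNReal.ofReal (Real.exp (-((1 - b) / 288 * N))) := by
  set c := a * Real.sqrt ((1 - b) / 8) / 6
  have hc : 0 < c := by
    have := Real.sqrt_pos.2 (by linarith : 0 < (1 - b) / 8)
    positivity
  set η := (1 - b) / 72
  set S : Fin N → Ω → ℝ := fun j ω => ∑ i, y i * A ω j i
  have mS : ∀ j, Measurable (S j) := fun j =>
    Finset.measurable_sum _ fun i _ => (mA j i).const_mul _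
  have hy2 : 1 / 4 ≤ ∑ i, y i ^ 2 := by
    have := EuclideanSpace.norm_sq_eq y
    simp only [Real.norm_eq_abs, sq_abs] at this
    rw [← this]; nlinarith
  have hη : 0 ≤ η := by simp only [η]; linarith
  have hrow : ∀ j, ∫⁻ ω, ENNReal.ofReal (Real.exp (-(S j ω ^ 2 / c ^ 2))) ∂P
      ≤ ENNReal.ofReal (1 - η / 2) := fun j =>
    lintegral_exp_neg_sq_le (mS j) hc hη
      (measure_abs_sum_ge (mA j) (hA.precomp (g := fun i => (j, i)) fun _ _ hi => (Prod.mk.inj hi).2)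
        ha hb0 hb1 (h j) y hy2)
  have hind : iIndepFun (fun j ω => ENNReal.ofReal (Real.exp (-(S j ω ^ 2 / c ^ 2)))) P :=
    (hA.curry (X := fun j i ω => A ω j i) mA).comp
      (fun _ v => ENNReal.ofReal (Real.exp (-((∑ i, y i * v i) ^ 2 / c ^ 2))))
      (fun _ => by fun_prop)
  have hprod : ∫⁻ ω, ∏ j, ENNReal.ofReal (Real.exp (-(S j ω ^ 2 / c ^ 2))) ∂P
      ≤ ENNReal.ofReal (Real.exp (-(η / 2 * N))) := by
    rw [lintegral_prod_eq_prod_lintegral_of_indepFun Finset.univ _ hind fun j => by fun_prop]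
    calc ∏ j, ∫⁻ ω, ENNReal.ofReal (Real.exp (-(S j ω ^ 2 / c ^ 2))) ∂P
        ≤ ∏ _j : Fin N, ENNReal.ofReal (Real.exp (-(η / 2))) := by
          refine Finset.prod_le_prod' fun j _ => (hrow j).trans (ENNReal.ofReal_le_ofReal ?_)
          linarith [Real.add_one_le_exp (-(η / 2))]
      _ = _ := by
          rw [Finset.prod_const, Finset.card_univ, Fintype.card_fin,
            ← ENNReal.ofReal_pow (Real.exp_pos _).le, ← Real.exp_nat_mul]
          ring_nf
  -- Exponential Markov: the mean is at most e^{-ηN/2}, and the threshold spends half of that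
  -- exponent, leaving η/4 = (1 - b)/288.
  have hsub : {ω | ‖Matrix.toEuclideanLin (A ω) y‖ ≤ c * Real.sqrt ((1 - b) / 288) * Real.sqrt N}
      ⊆ {ω | ENNReal.ofReal (Real.exp (-(η / 4 * N)))
        ≤ ∏ j, ENNReal.ofReal (Real.exp (-(S j ω ^ 2 / c ^ 2)))} := by
    intro ω hω
    simp only [Set.mem_ofPred_eq] at hω ⊢
    rw [← ENNReal.ofReal_prod_of_nonneg fun j _ => (Real.exp_pos _).le, ← Real.exp_sum]
    apply ENNReal.ofReal_le_ofReal
    rw [Real.exp_le_exp, Finset.sum_neg_distrib, neg_le_neg_iff, ← Finset.sum_div,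
      ← norm_toEuclideanLin_sq, div_le_iff₀ (by positivity)]
    calc ‖Matrix.toEuclideanLin (A ω) y‖ ^ 2
        ≤ (c * Real.sqrt ((1 - b) / 288) * Real.sqrt N) ^ 2 := by gcongr
      _ = η / 4 * N * c ^ 2 := by
          rw [mul_pow, mul_pow, Real.sq_sqrt (by linarith), Real.sq_sqrt (Nat.cast_nonneg N)]
          simp only [η]; ring
  refine (measure_mono hsub).trans ?_
  have hmk := (mul_meas_ge_le_lintegral₀ (μ := P)
    (f := fun ω => ∏ j, ENNReal.ofReal (Real.exp (-(S j ω ^ 2 / c ^ 2))))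
    (Finset.measurable_prod _ fun j _ => by fun_prop).aemeasurable
    (ENNReal.ofReal (Real.exp (-(η / 4 * N))))).trans hprod
  have hle : ENNReal.ofReal (Real.exp (-(η / 2 * N))) =
      ENNReal.ofReal (Real.exp (-(η / 4 * N))) * ENNReal.ofReal (Real.exp (-((1 - b) / 288 * N))) := by
    rw [← ENNReal.ofReal_mul (Real.exp_pos _).le, ← Real.exp_add]
    congr 2
    simp only [η]; ring
  rw [hle] at hmk
  exact (ENNReal.mul_le_mul_iff_right (by simpa using Real.exp_pos _) ENNReal.ofReal_ne_top).1 hmk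

end RandomMatrix

/-! ### Rounding to grids adapted to the columns. -/

lemma exists_int_mul_sub_mul_nonpos {h : ℝ} (hh : 0 < h) (x s : ℝ) :
    ∃ m : ℤ, |x - h * m| ≤ h ∧ (x - h * m) * s ≤ 0 := by
  have h1 : h * ⌊x / h⌋ ≤ x := by
    have := Int.floor_le (x / h)
    rwa [le_div_iff₀ hh, mul_comm] at this
  have h2 : x < h * (⌊x / h⌋ + 1) := by
    have := Int.lt_floor_add_one (x / h)
    rwa [div_lt_iff₀ hh, mul_comm] at this
  rcases le_total s 0 with hs | hs
  · exact ⟨⌊x / h⌋, by rw [abs_le]; constructor <;> linarith,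
      mul_nonpos_of_nonneg_of_nonpos (by linarith) hs⟩
  · refine ⟨⌊x / h⌋ + 1, ?_, mul_nonpos_of_nonpos_of_nonneg ?_ hs⟩
    · push_cast; rw [abs_le]; constructor <;> linarith
    · push_cast; linarith

/-- Rounding the coefficients of a linear combination to a rectangular lattice, choosing the
direction of each rounding so that the errors do not add up. -/
lemma exists_lattice_rounding {E ι : Type*} [NormedAddCommGroup E] [InnerProductSpace ℝ E]
    (v : ι → E) (x h : ι → ℝ) (hh : ∀ i, 0 < h i) (s : Finset ι) :
    ∃ z : ι → ℤ, (∀ i ∈ s, |x i - h i * z i| ≤ h i) ∧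
      ‖∑ i ∈ s, (x i - h i * z i) • v i‖ ^ 2 ≤ ∑ i ∈ s, h i ^ 2 * ‖v i‖ ^ 2 := by
  classical
  induction s using Finset.induction_on with
  | empty => exact ⟨0, by simp, by simp⟩
  | insert j s hj ih =>
    obtain ⟨z, hz, hzn⟩ := ih
    set u := ∑ i ∈ s, (x i - h i * z i) • v i
    -- Rounding against the sign of ⟨v j, u⟩ makes the cross term in the squared norm nonpositive: a
    -- deterministic version of random rounding.
    obtain ⟨m, hm, hms⟩ := exists_int_mul_sub_mul_nonpos (hh j) (x j) (inner ℝ (v j) u)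
    have hne : ∀ i ∈ s, Function.update z j m i = z i := fun i hi =>
      Function.update_of_ne (ne_of_mem_of_not_mem hi hj) _ _
    refine ⟨Function.update z j m, ?_, ?_⟩
    · intro i hi
      rcases Finset.mem_insert.1 hi with rfl | hi
      · simpa using hm
      · rw [hne i hi]; exact hz i hi
    · rw [Finset.sum_insert hj, Finset.sum_insert hj, Function.update_self,
        Finset.sum_congr rfl fun i hi => by rw [hne i hi]]
      change ‖(x j - h j * m) • v j + u‖ ^ 2 ≤ _
      rw [norm_add_sq_real, real_inner_smul_left, norm_smul, mul_pow, Real.norm_eq_abs, sq_abs]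
      have h1 : (x j - h j * m) ^ 2 ≤ h j ^ 2 := sq_le_sq' (abs_le.1 hm).1 (abs_le.1 hm).2
      have h2 := mul_le_mul_of_nonneg_right h1 (sq_nonneg ‖v j‖)
      linarith

/-- The point with coordinates `z i / (2 ^ k i * 2 * √n)`. -/
noncomputable def gridPoint {n : ℕ} (k : Fin n → ℕ) (z : Fin n → ℤ) :
    EuclideanSpace ℝ (Fin n) :=
  WithLp.toLp 2 fun i => (2 ^ k i * (2 * Real.sqrt n))⁻¹ * z i

lemma exists_four_pow_near {t : ℝ} :
    ∃ k : ℕ, t ≤ 4 ^ k ∧ (4 : ℝ) ^ k ≤ 4 * max 1 t := by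
  obtain ⟨k, h1, h2⟩ := exists_nat_pow_near (le_max_left 1 t) (by norm_num : (1 : ℝ) < 4)
  exact ⟨k + 1, (le_max_right 1 t).trans h2.le, by rw [pow_succ]; linarith⟩

/-- Every unit vector is approximated by a grid point, with an error controlled by the columns
of the matrix. -/
lemma exists_gridPoint_near {N n : ℕ} (hn : 1 ≤ n) (A : Matrix (Fin N) (Fin n) ℝ) {T : ℝ}
    (hT : 0 < T) (x : EuclideanSpace ℝ (Fin n)) (hx : ‖x‖ = 1) :
    ∃ (k : Fin n → ℕ) (z : Fin n → ℤ),
      (∏ i, (2 : ℝ) ^ k i) ^ 2 ≤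
        4 ^ n * ∏ i, max 1 (‖Matrix.toEuclideanLin A (EuclideanSpace.single i 1)‖ ^ 2 / T) ∧
      ∑ i, |(z i : ℝ)| / 2 ^ k i ≤ 3 * n ∧ 1 / 2 ≤ ‖gridPoint k z‖ ∧
      ‖Matrix.toEuclideanLin A (gridPoint k z)‖ ≤ ‖Matrix.toEuclideanLin A x‖ + Real.sqrt T := by
  set v : Fin n → EuclideanSpace ℝ (Fin N) :=
    fun i => Matrix.toEuclideanLin A (EuclideanSpace.single i 1)
  choose k hk1 hk2 using fun i => exists_four_pow_near (t := ‖v i‖ ^ 2 / T)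
  have hn0 : (0 : ℝ) < n := by exact_mod_cast hn
  have hsn : 0 < Real.sqrt n := Real.sqrt_pos.2 hn0
  have hsq : Real.sqrt n ^ 2 = n := Real.sq_sqrt hn0.le
  set h : Fin n → ℝ := fun i => (2 ^ k i * (2 * Real.sqrt n))⁻¹
  have hh : ∀ i, 0 < h i := fun i => by positivity
  have h4 : ∀ i, ((2 : ℝ) ^ k i) ^ 2 = 4 ^ k i := fun i => by
    rw [← pow_mul, mul_comm, pow_mul]; norm_num
  have hh2 : ∀ i, h i ^ 2 = ((4 : ℝ) ^ k i * (4 * n))⁻¹ := fun i => by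
    simp only [h]
    rw [inv_pow, mul_pow, h4, mul_pow, hsq]; norm_num
  obtain ⟨z, hz, hzn⟩ := exists_lattice_rounding v x h hh Finset.univ
  have hxs : ∑ i, x i ^ 2 = 1 := by
    have := EuclideanSpace.norm_sq_eq x
    simp only [Real.norm_eq_abs, sq_abs, hx] at this
    linarith
  have hle1 : ∀ i, (4 ^ k i * (4 * (n : ℝ)))⁻¹ ≤ (4 * (n : ℝ))⁻¹ := fun i => by
    apply inv_anti₀ (by positivity)
    have : (1 : ℝ) ≤ 4 ^ k i := one_le_pow₀ (by norm_num)
    nlinarith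
  refine ⟨k, z, ?_, ?_, ?_, ?_⟩
  · rw [← Finset.prod_pow]
    calc ∏ i, ((2 : ℝ) ^ k i) ^ 2 ≤ ∏ i, (4 * max 1 (‖v i‖ ^ 2 / T)) :=
          Finset.prod_le_prod (fun i _ => by positivity) fun i _ => by rw [h4]; exact hk2 i
      _ = _ := by rw [Finset.prod_mul_distrib]; simp [v]
  -- The two contributions are 2√n|x i| ≤ n(x i)² + 1 and a rounding error of at most one mesh,
  -- which scales to at most 1. Summing with |x| = 1 gives 3n.
  · have hterm : ∀ i, |(z i : ℝ)| / 2 ^ k i ≤ n * x i ^ 2 + 2 := by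
      intro i
      have e1 : |(z i : ℝ)| / 2 ^ k i = 2 * Real.sqrt n * |h i * z i| := by
        rw [abs_mul, abs_of_pos (hh i)]
        simp only [h]
        field_simp
      have e2 : |h i * z i| ≤ |x i| + h i := by
        have h5 := hz i (Finset.mem_univ i)
        have h6 := abs_sub_abs_le_abs_sub (h i * z i) (x i)
        rw [abs_sub_comm] at h6
        linarith
      have e3 : 2 * Real.sqrt n * h i ≤ 1 := by
        have : 2 * Real.sqrt n * h i = (2 ^ k i)⁻¹ := by simp only [h]; field_simp
        rw [this]
        exact inv_le_one_of_one_le₀ (one_le_pow₀ (by norm_num))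
      have e4 : 2 * Real.sqrt n * |x i| ≤ n * x i ^ 2 + 1 := by
        have h5 : (n : ℝ) * x i ^ 2 = (Real.sqrt n * |x i|) ^ 2 := by rw [mul_pow, hsq, sq_abs]
        rw [h5]
        nlinarith [sq_nonneg (Real.sqrt n * |x i| - 1)]
      rw [e1]
      nlinarith [mul_le_mul_of_nonneg_left e2 (by positivity : 0 ≤ 2 * Real.sqrt n)]
    calc ∑ i, |(z i : ℝ)| / 2 ^ k i ≤ ∑ i, (n * x i ^ 2 + 2) :=
          Finset.sum_le_sum fun i _ => hterm i
      _ = 3 * n := by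
          rw [Finset.sum_add_distrib, ← Finset.mul_sum, hxs]
          simp; ring
  · have hd : ‖x - gridPoint k z‖ ^ 2 ≤ (1 / 2) ^ 2 := by
      rw [EuclideanSpace.norm_sq_eq]
      calc ∑ i, ‖(x - gridPoint k z) i‖ ^ 2 ≤ ∑ _i : Fin n, (4 * (n : ℝ))⁻¹ := by
            refine Finset.sum_le_sum fun i _ => ?_
            refine le_trans ?_ (hle1 i)
            rw [← hh2]
            gcongr
            simpa [gridPoint, h] using hz i (Finset.mem_univ i)
        _ = (1 / 2) ^ 2 := by simp; field_simp; norm_num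
    have hd' : ‖x - gridPoint k z‖ ≤ 1 / 2 := le_of_sq_le_sq hd (by norm_num)
    have := norm_sub_norm_le x (gridPoint k z)
    linarith
  · have hdec : Matrix.toEuclideanLin A (x - gridPoint k z) = ∑ i, (x i - h i * z i) • v i := by
      have : x - gridPoint k z
          = ∑ i, (x i - h i * z i) • EuclideanSpace.single i (1 : ℝ) := by
        ext j
        simp [gridPoint, h, Finset.sum_apply, Pi.single_apply]
      rw [this, map_sum]
      simp [v]
    have hd : ‖Matrix.toEuclideanLin A (x - gridPoint k z)‖ ^ 2 ≤ T := by
      rw [hdec]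
      refine hzn.trans ?_
      -- The choice 4^k ≥ |Ae_i|²/T makes each term at most T/(4n).
      calc ∑ i, h i ^ 2 * ‖v i‖ ^ 2 ≤ ∑ _i : Fin n, T / n := by
            refine Finset.sum_le_sum fun i _ => ?_
            have h5 := hk1 i
            rw [div_le_iff₀ hT] at h5
            rw [hh2, inv_mul_le_iff₀ (by positivity)]
            have : (4 : ℝ) ^ k i * (4 * n) * (T / n) = 4 * (4 ^ k i * T) := by field_simp
            rw [this]
            have : 0 ≤ (4 : ℝ) ^ k i * T := by positivity
            linarith
        _ = T := by simp; field_simp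
    have hd' := Real.le_sqrt_of_sq_le hd
    have : Matrix.toEuclideanLin A (gridPoint k z)
        = Matrix.toEuclideanLin A x - Matrix.toEuclideanLin A (x - gridPoint k z) := by
      rw [map_sub]; abel
    rw [this]
    exact (norm_sub_le _ _).trans (by linarith)

/-! ### Weighted union bound over all grids. -/

lemma ENNReal.tsum_pi_prod {α : Type*} (f : α → ℝ≥0∞) (n : ℕ) :
    ∑' v : Fin n → α, ∏ i, f (v i) = (∑' x, f x) ^ n := by
  induction n with
  | zero => simp
  | succ n ih =>
    rw [← (Fin.consEquiv fun _ => α).tsum_eq, ENNReal.tsum_prod', pow_succ', ← ih,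
      ← ENNReal.tsum_mul_right]
    refine tsum_congr fun x => ?_
    rw [← ENNReal.tsum_mul_left]
    refine tsum_congr fun v => ?_
    simp [Fin.consEquiv, Fin.prod_univ_succ]

/-- Each half of ℤ gives a geometric series of ratio e^{-s} ≤ 1 - s/2 with s = 2^{-k} ≤ 1, hence a
sum of at most 2·2^k. -/
lemma tsum_int_exp_neg_abs_div_le (k : ℕ) :
    ∑' z : ℤ, ENNReal.ofReal (Real.exp (-(|(z : ℝ)| / 2 ^ k))) ≤ ENNReal.ofReal (4 * 2 ^ k) := by
  set s : ℝ := (2 ^ k)⁻¹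
  have hs0 : 0 < s := by positivity
  have hs1 : s ≤ 1 := inv_le_one_of_one_le₀ (one_le_pow₀ (by norm_num))
  have hnat : ∑' m : ℕ, ENNReal.ofReal (Real.exp (-(m * s))) ≤ ENNReal.ofReal (2 * 2 ^ k) := by
    have h1 : ∀ m : ℕ, ENNReal.ofReal (Real.exp (-(m * s))) = ENNReal.ofReal (Real.exp (-s)) ^ m := by
      intro m
      rw [← ENNReal.ofReal_pow (Real.exp_pos _).le, ← Real.exp_nat_mul]
      ring_nf
    simp_rw [h1]
    rw [ENNReal.tsum_geometric]
    have h2 : Real.exp (-s) ≤ 1 - s / 2 := by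
      rw [Real.exp_neg]
      refine inv_le_of_inv_le₀ (by linarith) ?_
      refine le_trans ?_ (Real.add_one_le_exp s)
      rw [inv_le_iff_one_le_mul₀ (by linarith)]
      nlinarith
    have h3 : ENNReal.ofReal (s / 2) ≤ 1 - ENNReal.ofReal (Real.exp (-s)) := by
      rw [← ENNReal.ofReal_one, ← ENNReal.ofReal_sub _ (Real.exp_pos _).le]
      apply ENNReal.ofReal_le_ofReal; linarith
    refine (ENNReal.inv_le_inv.2 h3).trans (le_of_eq ?_)
    rw [← ENNReal.ofReal_inv_of_pos (by positivity)]
    congr 1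
    simp only [s]
    field_simp
  rw [tsum_of_nat_of_neg_add_one ENNReal.summable ENNReal.summable,
    show (4 : ℝ) * 2 ^ k = 2 * 2 ^ k + 2 * 2 ^ k by ring,
    ENNReal.ofReal_add (by positivity) (by positivity)]
  refine add_le_add (le_trans (le_of_eq ?_) hnat) (le_trans (ENNReal.tsum_le_tsum fun m => ?_) hnat)
  · refine tsum_congr fun m => ?_
    simp [s, div_eq_mul_inv]
  · apply ENNReal.ofReal_le_ofReal
    rw [Real.exp_le_exp, neg_le_neg_iff, ← div_eq_mul_inv]
    gcongr
    push_cast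
    rw [abs_neg, abs_of_nonneg (by positivity)]
    linarith

/-- The inner sum costs 4·2^k, so the factor 4^{-k} leaves the summable 4·2^{-k}. This weight makes
a union bound over infinitely many meshes possible. -/
lemma tsum_grid_weight_le :
    ∑' q : ℕ × ℤ, ENNReal.ofReal ((4 ^ q.1)⁻¹ * Real.exp (-(|(q.2 : ℝ)| / 2 ^ q.1))) ≤ 8 := by
  rw [ENNReal.tsum_prod']
  calc ∑' (k : ℕ) (z : ℤ), ENNReal.ofReal ((4 ^ k)⁻¹ * Real.exp (-(|(z : ℝ)| / 2 ^ k)))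
      ≤ ∑' k : ℕ, 4 * (2 : ℝ≥0∞)⁻¹ ^ k := by
        refine ENNReal.tsum_le_tsum fun k => ?_
        simp_rw [ENNReal.ofReal_mul (show (0 : ℝ) ≤ (4 ^ k)⁻¹ by positivity)]
        rw [ENNReal.tsum_mul_left]
        refine (mul_le_mul_right (tsum_int_exp_neg_abs_div_le k) _).trans (le_of_eq ?_)
        rw [← ENNReal.ofReal_mul (by positivity)]
        have h1 : ((4 : ℝ) ^ k)⁻¹ * (4 * 2 ^ k) = 4 * (2⁻¹) ^ k := by
          rw [show (4 : ℝ) ^ k = 2 ^ k * 2 ^ k by rw [← mul_pow]; norm_num, inv_pow]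
          field_simp
        rw [h1, ENNReal.ofReal_mul (by norm_num), ENNReal.ofReal_pow (by norm_num),
          ENNReal.ofReal_inv_of_pos (by norm_num)]
        simp
    _ = 8 := by
        rw [ENNReal.tsum_mul_left, ENNReal.tsum_geometric, ENNReal.one_sub_inv_two, inv_inv]
        norm_num

/-- Union bound over all grids whose mesh product is bounded below. -/
lemma measure_exists_grid_le {Ω : Type*} [MeasurableSpace Ω] (P : Measure Ω) {n : ℕ}
    (E : (Fin n → ℕ) → (Fin n → ℤ) → Set Ω) {ρ : ℝ≥0∞} (hE : ∀ k z, P (E k z) ≤ ρ)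
    (W L : ℝ) (hW : 0 < W) :
    P {ω | ∃ k z, (∏ i, (2 : ℝ) ^ k i) ^ 2 ≤ W ∧ ∑ i, |(z i : ℝ)| / 2 ^ k i ≤ L ∧ ω ∈ E k z}
      ≤ ρ * ENNReal.ofReal (W * Real.exp L * 8 ^ n) := by
  set f : ℕ × ℤ → ℝ≥0∞ := fun q =>
    ENNReal.ofReal ((4 ^ q.1)⁻¹ * Real.exp (-(|(q.2 : ℝ)| / 2 ^ q.1)))
  set F : (Fin n → ℕ × ℤ) → Set Ω := fun v =>
    {ω | (∏ i, (2 : ℝ) ^ (v i).1) ^ 2 ≤ W ∧ ∑ i, |((v i).2 : ℝ)| / 2 ^ (v i).1 ≤ L ∧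
      ω ∈ E (fun i => (v i).1) (fun i => (v i).2)}
  have hF : ∀ v, P (F v) ≤ ρ * ENNReal.ofReal (W * Real.exp L) * ∏ i, f (v i) := by
    intro v
    by_cases hv : (∏ i, (2 : ℝ) ^ (v i).1) ^ 2 ≤ W ∧ ∑ i, |((v i).2 : ℝ)| / 2 ^ (v i).1 ≤ L
    -- The constraints bound the product weight below by 1/(W e^L), so inserting it costs only the
    -- factor W e^L.
    · have h1 : 1 ≤ ENNReal.ofReal (W * Real.exp L) * ∏ i, f (v i) := by
        simp only [f]
        rw [← ENNReal.ofReal_prod_of_nonneg fun i _ => by positivity,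
          ← ENNReal.ofReal_mul (by positivity), ENNReal.one_le_ofReal,
          Finset.prod_mul_distrib, ← Real.exp_sum, Finset.sum_neg_distrib, Finset.prod_inv_distrib]
        have h2 : ∏ i, (4 : ℝ) ^ (v i).1 = (∏ i, (2 : ℝ) ^ (v i).1) ^ 2 := by
          rw [← Finset.prod_pow]
          refine Finset.prod_congr rfl fun i _ => ?_
          rw [← pow_mul, mul_comm, pow_mul]; norm_num
        have hpos : 0 < (∏ i, (2 : ℝ) ^ (v i).1) ^ 2 := by positivity
        rw [h2, mul_mul_mul_comm, ← Real.exp_add]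
        have h3 : 1 ≤ W * ((∏ i, (2 : ℝ) ^ (v i).1) ^ 2)⁻¹ := by
          rw [← div_eq_mul_inv, one_le_div hpos]; exact hv.1
        have h4 : 1 ≤ Real.exp (L + -∑ i, |((v i).2 : ℝ)| / 2 ^ (v i).1) :=
          Real.one_le_exp (by linarith [hv.2])
        exact one_le_mul_of_one_le_of_one_le h3 h4
      calc P (F v) ≤ ρ := (measure_mono fun ω hω => hω.2.2).trans (hE _ _)
        _ ≤ ρ * (ENNReal.ofReal (W * Real.exp L) * ∏ i, f (v i)) := le_mul_of_one_le_right' h1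
        _ = _ := (mul_assoc _ _ _).symm
    · have : F v = ∅ := by
        ext ω
        simp only [F, Set.mem_ofPred_eq, Set.mem_empty_iff_false, iff_false]
        exact fun h => hv ⟨h.1, h.2.1⟩
      simp [this]
  have hsub : {ω | ∃ k z, (∏ i, (2 : ℝ) ^ k i) ^ 2 ≤ W ∧ ∑ i, |(z i : ℝ)| / 2 ^ k i ≤ L ∧ ω ∈ E k z}
      ⊆ ⋃ v, F v := by
    rintro ω ⟨k, z, h⟩
    exact Set.mem_iUnion.2 ⟨fun i => (k i, z i), h⟩
  refine (measure_mono hsub).trans ((measure_iUnion_le _).trans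
    ((ENNReal.tsum_le_tsum hF).trans ?_))
  rw [ENNReal.tsum_mul_left, ENNReal.tsum_pi_prod,
    ENNReal.ofReal_mul (p := W * Real.exp L) (by positivity), mul_assoc,
    ENNReal.ofReal_pow (by norm_num)]
  gcongr
  refine tsum_grid_weight_le.trans (by simp)

/-! ### Tail of the product of column norms. -/

lemma max_one_rpow_le {u p : ℝ} (hu : 0 ≤ u) : max 1 u ^ p ≤ 1 + u ^ p := by
  rcases le_total 1 u with h | h
  · rw [max_eq_right h]; linarith
  · rw [max_eq_left h, Real.one_rpow]; linarith [Real.rpow_nonneg hu p]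

lemma one_add_rpow_le {u p : ℝ} (hu : 0 ≤ u) (hp : 0 ≤ p) : 1 + u ^ p ≤ 2 * (1 + u) ^ p := by
  have h1 : 1 ≤ (1 + u) ^ p := Real.one_le_rpow (by linarith) hp
  have h2 : u ^ p ≤ (1 + u) ^ p := Real.rpow_le_rpow hu (by linarith) hp
  linarith

/-- The AM-GM inequality, from a tangent-line bound at the mean; the exponents sum to at most 0. -/
lemma prod_one_add_le_pow {n : ℕ} {u : Fin n → ℝ} (hu : ∀ i, 0 ≤ u i) {s : ℝ} (hs : 0 ≤ s)
    (h : ∑ i, u i ≤ n * s) : ∏ i, (1 + u i) ≤ (1 + s) ^ n := by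
  have h1 : ∀ i, 1 + u i ≤ (1 + s) * Real.exp ((1 + u i) / (1 + s) - 1) := fun i => by
    have := Real.add_one_le_exp ((1 + u i) / (1 + s) - 1)
    rw [sub_add_cancel, div_le_iff₀ (by linarith), mul_comm] at this
    exact this
  calc ∏ i, (1 + u i) ≤ ∏ i, ((1 + s) * Real.exp ((1 + u i) / (1 + s) - 1)) :=
        Finset.prod_le_prod (fun i _ => by linarith [hu i]) fun i _ => h1 i
    _ = (1 + s) ^ n * Real.exp (∑ i, ((1 + u i) / (1 + s) - 1)) := by
        rw [Finset.prod_mul_distrib, ← Real.exp_sum]; simp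
    _ ≤ (1 + s) ^ n * 1 := by
        gcongr
        rw [Real.exp_le_one_iff, Finset.sum_sub_distrib, ← Finset.sum_div, Finset.sum_add_distrib]
        simp only [Finset.sum_const, Finset.card_univ, Fintype.card_fin, nsmul_eq_mul, mul_one]
        rw [sub_nonpos, div_le_iff₀ (by linarith)]
        linarith
    _ = (1 + s) ^ n := mul_one _

section Moments

variable {Ω : Type*} [MeasurableSpace Ω] {P : Measure Ω} [IsProbabilityMeasure P]

/-- Tail bound for a product of truncated independent variables with finite moments. -/
lemma measure_lt_prod_max_le {n : ℕ} {Y : Fin n → Ω → ℝ} (mY : ∀ i, Measurable (Y i))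
    (hY : iIndepFun Y P) (hY0 : ∀ i ω, 0 ≤ Y i ω) {p T B D : ℝ} (hp : 0 < p) (hT : 0 < T)
    (hB : 0 ≤ B) (hD : 0 < D)
    (h : ∑ i, (∫⁻ ω, ENNReal.ofReal (Y i ω ^ (2 * p)) ∂P) ^ (1 / p) ≤ ENNReal.ofReal (n * B)) :
    P {ω | D < ∏ i, max 1 (Y i ω ^ 2 / T)} ≤
      ENNReal.ofReal (2 ^ n * ((1 + B / T) ^ n) ^ p / D ^ p) := by
  set M : Fin n → ℝ≥0∞ := fun i => ∫⁻ ω, ENNReal.ofReal (Y i ω ^ (2 * p)) ∂P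
  set m : Fin n → ℝ := fun i => (M i ^ (1 / p)).toReal
  -- The finite bound on the sum forces each moment to be finite, so the moments can be treated as
  -- real numbers.
  have hfin : ∀ i, M i ^ (1 / p) ≠ ⊤ := fun i =>
    ne_top_of_le_ne_top ENNReal.ofReal_ne_top ((Finset.single_le_sum
      (f := fun i => M i ^ (1 / p)) (fun _ _ => zero_le) (Finset.mem_univ i)).trans h)
  have hm0 : ∀ i, 0 ≤ m i := fun i => ENNReal.toReal_nonneg
  have hM : ∀ i, M i = ENNReal.ofReal (m i ^ p) := fun i => by
    rw [← ENNReal.ofReal_rpow_of_nonneg (hm0 i) hp.le, ENNReal.ofReal_toReal (hfin i),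
      ← ENNReal.rpow_mul, one_div, inv_mul_cancel₀ hp.ne', ENNReal.rpow_one]
  have hmsum : ∑ i, m i ≤ n * B := by
    rw [← ENNReal.ofReal_le_ofReal_iff (by positivity),
      ENNReal.ofReal_sum_of_nonneg fun i _ => hm0 i]
    refine le_trans (le_of_eq ?_) h
    exact Finset.sum_congr rfl fun i _ => ENNReal.ofReal_toReal (hfin i)
  have hpow : ∀ i ω, (Y i ω ^ 2 / T) ^ p = (T ^ p)⁻¹ * Y i ω ^ (2 * p) := fun i ω => by
    rw [Real.div_rpow (sq_nonneg _) hT.le, Real.rpow_mul (hY0 i ω), Real.rpow_two, div_eq_inv_mul]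
  have hone : ∀ i, ∫⁻ ω, ENNReal.ofReal (1 + (Y i ω ^ 2 / T) ^ p) ∂P
      ≤ ENNReal.ofReal (2 * (1 + m i / T) ^ p) := by
    intro i
    have h1 : ∀ ω, ENNReal.ofReal (1 + (Y i ω ^ 2 / T) ^ p)
        = 1 + ENNReal.ofReal (T ^ p)⁻¹ * ENNReal.ofReal (Y i ω ^ (2 * p)) := fun ω => by
      have := Real.rpow_nonneg (hY0 i ω) (2 * p)
      have := Real.rpow_pos_of_pos hT p
      rw [hpow, ENNReal.ofReal_add (by norm_num) (by positivity), ENNReal.ofReal_mul (by positivity),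
        ENNReal.ofReal_one]
    simp_rw [h1]
    rw [lintegral_add_left measurable_const, lintegral_const_mul _ (by fun_prop)]
    change ∫⁻ _, 1 ∂P + _ * M i ≤ _
    have := Real.rpow_pos_of_pos hT p
    have := Real.rpow_nonneg (hm0 i) p
    rw [hM, ← ENNReal.ofReal_mul (by positivity), lintegral_const, measure_univ, mul_one,
      ← ENNReal.ofReal_one, ← ENNReal.ofReal_add (by norm_num) (by positivity)]
    apply ENNReal.ofReal_le_ofReal
    rw [← div_eq_inv_mul, ← Real.div_rpow (hm0 i) hT.le]
    exact one_add_rpow_le (div_nonneg (hm0 i) hT.le) hp.le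
  have hind : iIndepFun (fun i ω => ENNReal.ofReal (1 + (Y i ω ^ 2 / T) ^ p)) P :=
    hY.comp (fun _ y => ENNReal.ofReal (1 + (y ^ 2 / T) ^ p)) fun _ => by fun_prop
  have hprod : ∫⁻ ω, ∏ i, ENNReal.ofReal (1 + (Y i ω ^ 2 / T) ^ p) ∂P
      ≤ ENNReal.ofReal (2 ^ n * ((1 + B / T) ^ n) ^ p) := by
    rw [lintegral_prod_eq_prod_lintegral_of_indepFun Finset.univ _ hind fun i => by fun_prop]
    refine (Finset.prod_le_prod' fun i _ => hone i).trans ?_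
    have hnn : ∀ i, 0 ≤ 1 + m i / T := fun i => by have := hm0 i; positivity
    rw [← ENNReal.ofReal_prod_of_nonneg fun i _ => by
      have := Real.rpow_nonneg (hnn i) p; positivity]
    apply ENNReal.ofReal_le_ofReal
    rw [Finset.prod_mul_distrib, Real.finsetProd_rpow _ _ fun i _ => hnn i]
    simp only [Finset.prod_const, Finset.card_univ, Fintype.card_fin]
    gcongr
    refine prod_one_add_le_pow (fun i => div_nonneg (hm0 i) hT.le) (by positivity) ?_
    rw [← Finset.sum_div, ← mul_div_assoc]
    gcongr
  have hDp := Real.rpow_pos_of_pos hD p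
  have hsub : {ω | D < ∏ i, max 1 (Y i ω ^ 2 / T)}
      ⊆ {ω | ENNReal.ofReal (D ^ p) ≤ ∏ i, ENNReal.ofReal (1 + (Y i ω ^ 2 / T) ^ p)} := by
    intro ω hω
    simp only [Set.mem_ofPred_eq] at hω ⊢
    have hu : ∀ i, 0 ≤ Y i ω ^ 2 / T := fun i => by positivity
    rw [← ENNReal.ofReal_prod_of_nonneg fun i _ => by
      have := Real.rpow_nonneg (hu i) p; positivity]
    apply ENNReal.ofReal_le_ofReal
    calc D ^ p ≤ (∏ i, max 1 (Y i ω ^ 2 / T)) ^ p := Real.rpow_le_rpow hD.le hω.le hp.le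
      _ = ∏ i, max 1 (Y i ω ^ 2 / T) ^ p := by
          rw [Real.finsetProd_rpow _ _ fun i _ => le_max_of_le_left zero_le_one]
      _ ≤ ∏ i, (1 + (Y i ω ^ 2 / T) ^ p) :=
          Finset.prod_le_prod (fun i _ => Real.rpow_nonneg (le_max_of_le_left zero_le_one) _)
            fun i _ => max_one_rpow_le (hu i)
  refine (measure_mono hsub).trans ?_
  have hmk := (mul_meas_ge_le_lintegral₀ (μ := P)
    (f := fun ω => ∏ i, ENNReal.ofReal (1 + (Y i ω ^ 2 / T) ^ p))
    (Finset.measurable_prod _ fun i _ => by fun_prop).aemeasurable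
    (ENNReal.ofReal (D ^ p))).trans hprod
  rw [ENNReal.ofReal_div_of_pos hDp, ENNReal.le_div_iff_mul_le (Or.inl (by simpa using hDp))
    (Or.inl ENNReal.ofReal_ne_top), mul_comm]
  exact hmk

lemma norm_toEuclideanLin_single {N n : ℕ} (A : Matrix (Fin N) (Fin n) ℝ) (i : Fin n) :
    ‖Matrix.toEuclideanLin A (EuclideanSpace.single i 1)‖ = Real.sqrt (∑ j, A j i ^ 2) := by
  rw [← Real.sqrt_sq (norm_nonneg _), norm_toEuclideanLin_sq]
  simp

lemma measure_lt_prod_max_column_le {N n : ℕ} {A : Ω → Matrix (Fin N) (Fin n) ℝ}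
    (mA : ∀ j i, Measurable (fun ω => A ω j i))
    (hA : iIndepFun (fun (ji : Fin N × Fin n) (ω : Ω) => A ω ji.1 ji.2) P)
    {p T B D : ℝ} (hp : 0 < p) (hT : 0 < T) (hB : 0 ≤ B) (hD : 0 < D)
    (h : columnMomentSum P A p ≤ ENNReal.ofReal (n * B)) :
    P {ω | D < ∏ i, max 1 (‖Matrix.toEuclideanLin (A ω) (EuclideanSpace.single i 1)‖ ^ 2 / T)} ≤
      ENNReal.ofReal (2 ^ n * ((1 + B / T) ^ n) ^ p / D ^ p) := by
  have hcol : iIndepFun (fun i ω (j : Fin N) => A ω j i) P :=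
    ProbabilityTheory.iIndepFun.curry (X := fun i j ω => A ω j i) (fun i j => mA j i)
      (hA.precomp (g := Prod.swap) Prod.swap_injective)
  refine measure_lt_prod_max_le
    (Y := fun i ω => ‖Matrix.toEuclideanLin (A ω) (EuclideanSpace.single i 1)‖)
    (fun i => ?_) ?_ (fun i ω => norm_nonneg _) hp hT hB hD h
  · simp_rw [norm_toEuclideanLin_single]
    fun_prop
  · simp_rw [norm_toEuclideanLin_single]
    exact hcol.comp (fun _ v => Real.sqrt (∑ j, v j ^ 2)) fun _ => by fun_prop

end Moments

/-! ### Assembly and choice of constants. -/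

lemma exists_norm_lt_of_smallestSingularValue_lt {N n : ℕ} (hn : 1 ≤ n)
    (A : Matrix (Fin N) (Fin n) ℝ) {r : ℝ} (h : smallestSingularValue A < r) :
    ∃ x : EuclideanSpace ℝ (Fin n), ‖x‖ = 1 ∧ ‖Matrix.toEuclideanLin A x‖ < r := by
  have : Nonempty (Metric.sphere (0 : EuclideanSpace ℝ (Fin n)) 1) :=
    ⟨EuclideanSpace.single ⟨0, hn⟩ 1, by simp⟩
  obtain ⟨x, hx⟩ := exists_lt_of_ciInf_lt h
  exact ⟨x, by simp, hx⟩

/-- The smallest singular value is small only if a product of column norms is large or some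
grid point is mapped to a short vector. -/
lemma measure_smallestSingularValue_le {Ω : Type*} [MeasurableSpace Ω] (P : Measure Ω)
    {N n : ℕ} (hn : 1 ≤ n) (A : Ω → Matrix (Fin N) (Fin n) ℝ) {r D : ℝ} (hr : 0 < r) (hD : 0 < D)
    {ρ : ℝ≥0∞} (hρ : ∀ y : EuclideanSpace ℝ (Fin n), 1 / 2 ≤ ‖y‖ →
      P {ω | ‖Matrix.toEuclideanLin (A ω) y‖ ≤ 3 * r} ≤ ρ) :
    P {ω | smallestSingularValue (A ω) ≤ r} ≤
      P {ω | D < ∏ i, max 1 (‖Matrix.toEuclideanLin (A ω) (EuclideanSpace.single i 1)‖ ^ 2 / r ^ 2)}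
        + ρ * ENNReal.ofReal (4 ^ n * D * Real.exp (3 * n) * 8 ^ n) := by
  set E : (Fin n → ℕ) → (Fin n → ℤ) → Set Ω := fun k z =>
    {ω | 1 / 2 ≤ ‖gridPoint k z‖ ∧ ‖Matrix.toEuclideanLin (A ω) (gridPoint k z)‖ ≤ 3 * r}
  have hE : ∀ k z, P (E k z) ≤ ρ := by
    intro k z
    by_cases hg : 1 / 2 ≤ ‖gridPoint k z‖
    · exact (measure_mono fun ω hω => hω.2).trans (hρ _ hg)
    · have : E k z = ∅ := by
        ext ω
        simp only [E, Set.mem_ofPred_eq, Set.mem_empty_iff_false, iff_false]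
        exact fun h => hg h.1
      simp [this]
  refine le_trans (le_trans (measure_mono ?_) (measure_union_le _ _))
    (add_le_add le_rfl (measure_exists_grid_le P E hE (4 ^ n * D) (3 * n) (by positivity)))
  intro ω hω
  -- Relaxing `r` to `2 * r` avoids using that the infimum is attained. The rounding error √(r²) = r
  -- then gives `3 * r`.
  obtain ⟨x, hx1, hx2⟩ := exists_norm_lt_of_smallestSingularValue_lt hn (A ω)
    (lt_of_le_of_lt hω (by linarith : r < 2 * r))
  obtain ⟨k, z, h1, h2, h3, h4⟩ := exists_gridPoint_near hn (A ω) (sq_pos_of_pos hr) x hx1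
  rw [Real.sqrt_sq hr.le] at h4
  by_cases hprod : D < ∏ i, max 1
      (‖Matrix.toEuclideanLin (A ω) (EuclideanSpace.single i 1)‖ ^ 2 / r ^ 2)
  · exact Or.inl hprod
  · refine Or.inr ⟨k, z, h1.trans ?_, h2, h3, by linarith⟩
    gcongr
    exact not_lt.1 hprod

theorem proposition5p1 (a b K : ℝ) (ha : 0 < a) (hb0 : 0 < b) (hb1 : b < 1) (hK : 0 < K) :
    ∃ C₂ : ℝ, 0 < C₂ ∧ ∀ p : ℝ, 0 < p →
      ∃ c₀ C₀ C₁ : ℝ, 0 < c₀ ∧ 0 < C₀ ∧ 0 < C₁ ∧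
        ∀ (N n : ℕ), 1 ≤ n → C₀ * (n : ℝ) ≤ (N : ℝ) →
        ∀ (Ω : Type*) [MeasurableSpace Ω] (P : Measure Ω) [IsProbabilityMeasure P]
          (A : Ω → Matrix (Fin N) (Fin n) ℝ),
          (∀ j i, Measurable (fun ω => A ω j i)) →
          iIndepFun (fun (ji : Fin N × Fin n) (ω : Ω) => A ω ji.1 ji.2) P →
          (∀ j i, BoundedConcentration P (fun ω => A ω j i) a b) →
          columnMomentSum P A p ≤
            ENNReal.ofReal (K * (n : ℝ) * (N : ℝ) * Real.exp (c₀ * (N : ℝ) / (n : ℝ))) →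
          P {ω | smallestSingularValue (A ω) ≤ C₁ * Real.sqrt (N : ℝ)} ≤
            ENNReal.ofReal (Real.exp (-(C₂ * min p 1 * (N : ℝ)))) := by
  obtain ⟨γ, hγdef⟩ : ∃ γ, γ = (1 - b) / 288 := ⟨_, rfl⟩
  have hγ : 0 < γ := by rw [hγdef]; linarith
  obtain ⟨τ, hτdef⟩ : ∃ τ, τ = a * Real.sqrt ((1 - b) / 8) / 6 * Real.sqrt ((1 - b) / 288) :=
    ⟨_, rfl⟩
  have hτ : 0 < τ := by
    have := Real.sqrt_pos.2 (by linarith : 0 < (1 - b) / 8)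
    have := Real.sqrt_pos.2 (by linarith : 0 < (1 - b) / 288)
    rw [hτdef]; positivity
  refine ⟨γ / 16, by positivity, fun p hp => ?_⟩
  set m := min p 1
  have hm : 0 < m := lt_min hp one_pos
  have hmp : m ≤ p := min_le_left _ _
  have hm1 : m ≤ 1 := min_le_right _ _
  -- Chosen so that `3 * r` is exactly the small ball radius τ√N.
  set C₁ := τ / 3
  have hC₁ : 0 < C₁ := by positivity
  set Q := 1 + K / C₁ ^ 2
  have hQ1 : 1 < Q := by
    have : 0 < K / C₁ ^ 2 := by positivity
    simp only [Q]; linarith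
  have hlQ : 0 < Real.log Q := Real.log_pos hQ1
  have hl2 : 0 < Real.log 2 := Real.log_pos one_lt_two
  have hl32 : 0 < Real.log 32 := Real.log_pos (by norm_num)
  -- Each summand of the aspect-ratio constant secures one of `k1` to `k4`: absorbing the union
  -- bound factor (32e³)^n, the 2^n and Q^{np} of the moment bound, and the final factor 2.
  refine ⟨γ / 16, 4 * (Real.log 32 + 3) / γ + 32 * Real.log 2 / (p * γ) + 32 * Real.log Q / γ
    + 16 * Real.log 2 / (m * γ), C₁, by positivity, by positivity, hC₁, ?_⟩
  intro N n hn hN Ω _ P _ A mA hA hconc hmom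
  have hn1 : (1 : ℝ) ≤ n := by exact_mod_cast hn
  have hn0 : (0 : ℝ) < n := by linarith
  have key : ∀ t s : ℝ, 0 < s → t / s ≤ 4 * (Real.log 32 + 3) / γ + 32 * Real.log 2 / (p * γ)
      + 32 * Real.log Q / γ + 16 * Real.log 2 / (m * γ) → t * n ≤ s * N := by
    intro t s hs hts
    have h1 := (mul_le_mul_of_nonneg_right hts hn0.le).trans hN
    rw [div_mul_eq_mul_div, div_le_iff₀ hs] at h1
    linarith
  have p1 : 0 < 4 * (Real.log 32 + 3) / γ := by positivity
  have p2 : 0 < 32 * Real.log 2 / (p * γ) := by positivity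
  have p3 : 0 < 32 * Real.log Q / γ := by positivity
  have p4 : 0 < 16 * Real.log 2 / (m * γ) := by positivity
  have k1 := key _ _ hγ (by linarith : 4 * (Real.log 32 + 3) / γ ≤ _)
  have k2 := key _ _ (mul_pos hp hγ) (by linarith : 32 * Real.log 2 / (p * γ) ≤ _)
  have k3 := key _ _ hγ (by linarith : 32 * Real.log Q / γ ≤ _)
  have k4 := key _ _ (mul_pos hm hγ) (by linarith : 16 * Real.log 2 / (m * γ) ≤ _)
  have hN0 : (0 : ℝ) < N := by
    refine lt_of_lt_of_le ?_ hN
    positivity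
  have hsN : 0 < Real.sqrt N := Real.sqrt_pos.2 hN0
  set r := C₁ * Real.sqrt N
  have hr : 0 < r := by positivity
  have hr2 : r ^ 2 = C₁ ^ 2 * N := by rw [mul_pow, Real.sq_sqrt hN0.le]
  -- This cutoff costs a quarter of the small ball exponent, while its p-th power still beats the
  -- growth e^{pγN/16} allowed by the moments.
  set D := Real.exp (γ / 4 * N)
  have hball : ∀ y : EuclideanSpace ℝ (Fin n), 1 / 2 ≤ ‖y‖ →
      P {ω | ‖Matrix.toEuclideanLin (A ω) y‖ ≤ 3 * r} ≤ ENNReal.ofReal (Real.exp (-(γ * N))) := by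
    intro y hy
    have := measure_norm_toEuclideanLin_le mA hA ha hb0 hb1 hconc y hy
    rw [← hτdef, ← hγdef] at this
    rwa [show 3 * r = τ * Real.sqrt N by simp only [r, C₁]; ring]
  refine (measure_smallestSingularValue_le P hn A hr (Real.exp_pos (γ / 4 * N)) hball).trans ?_
  have hcolumns := measure_lt_prod_max_column_le mA hA (T := r ^ 2)
    (B := K * N * Real.exp (γ / 16 * N / n)) hp (by positivity) (by positivity)
    (Real.exp_pos (γ / 4 * N)) (hmom.trans (le_of_eq (by ring_nf)))
  have hexp1 : ((1 + K * N * Real.exp (γ / 16 * N / n) / r ^ 2) ^ n) ^ p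
      ≤ Real.exp (p * (n * Real.log Q + γ / 16 * N)) := by
    have h1 : 1 + K * N * Real.exp (γ / 16 * N / n) / r ^ 2 ≤ Q * Real.exp (γ / 16 * N / n) := by
      have h2 : K * N * Real.exp (γ / 16 * N / n) / r ^ 2
          = K / C₁ ^ 2 * Real.exp (γ / 16 * N / n) := by rw [hr2]; field_simp
      have h3 : 1 ≤ Real.exp (γ / 16 * N / n) := Real.one_le_exp (by positivity)
      rw [h2]; simp only [Q]; linarith
    calc ((1 + K * N * Real.exp (γ / 16 * N / n) / r ^ 2) ^ n) ^ p
        ≤ ((Q * Real.exp (γ / 16 * N / n)) ^ n) ^ p := by gcongr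
      _ = Real.exp (p * (n * Real.log Q + γ / 16 * N)) := by
          rw [← Real.exp_log (by linarith : 0 < Q), ← Real.exp_add, ← Real.exp_nat_mul,
            ← Real.exp_mul, Real.log_exp]
          congr 1
          field_simp
  have h2n : (2 : ℝ) ^ n = Real.exp (n * Real.log 2) := by
    rw [Real.exp_nat_mul, Real.exp_log two_pos]
  have h32n : (4 : ℝ) ^ n * 8 ^ n = Real.exp (n * Real.log 32) := by
    rw [Real.exp_nat_mul, Real.exp_log (by norm_num), ← mul_pow]; norm_num
  have hfirst : 2 ^ n * ((1 + K * N * Real.exp (γ / 16 * N / n) / r ^ 2) ^ n) ^ p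
      / Real.exp (γ / 4 * N) ^ p ≤ Real.exp (-(m * γ * N / 8)) := by
    calc _ ≤ Real.exp (n * Real.log 2) * Real.exp (p * (n * Real.log Q + γ / 16 * N))
          / Real.exp (γ / 4 * N) ^ p := by rw [h2n]; gcongr
      _ = Real.exp (n * Real.log 2 + p * (n * Real.log Q + γ / 16 * N) - γ / 4 * N * p) := by
          rw [← Real.exp_add, ← Real.exp_mul, ← Real.exp_sub]
      _ ≤ Real.exp (-(m * γ * N / 8)) := by
          rw [Real.exp_le_exp]
          -- In units of pγN the exponent is at most 1/32 + 1/32 + 1/16 - 1/4 = -1/8.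
          have e1 := mul_le_mul_of_nonneg_left k3 hp.le
          have e2 := mul_le_mul_of_nonneg_right hmp (by positivity : 0 ≤ γ * N)
          linarith
  have hsecond : Real.exp (-(γ * N)) * (4 ^ n * Real.exp (γ / 4 * N) * Real.exp (3 * n) * 8 ^ n)
      ≤ Real.exp (-(m * γ * N / 8)) := by
    calc _ = Real.exp (-(γ * N)) * (4 ^ n * 8 ^ n * Real.exp (γ / 4 * N) * Real.exp (3 * n)) := by
          ring
      _ = Real.exp (-(γ * N) + (n * Real.log 32 + γ / 4 * N + 3 * n)) := by
          rw [h32n, ← Real.exp_add, ← Real.exp_add, ← Real.exp_add]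
      _ ≤ Real.exp (-(m * γ * N / 8)) := by
          rw [Real.exp_le_exp]
          have e2 := mul_le_mul_of_nonneg_right hm1 (by positivity : 0 ≤ γ * N)
          linarith [mul_pos hγ hN0]
  rw [← ENNReal.ofReal_mul (Real.exp_pos _).le]
  refine (add_le_add (hcolumns.trans (ENNReal.ofReal_le_ofReal hfirst))
    (ENNReal.ofReal_le_ofReal hsecond)).trans ?_
  rw [← ENNReal.ofReal_add (Real.exp_pos _).le (Real.exp_pos _).le]
  apply ENNReal.ofReal_le_ofReal
  calc Real.exp (-(m * γ * N / 8)) + Real.exp (-(m * γ * N / 8))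
      = Real.exp (Real.log 2 + -(m * γ * N / 8)) := by
        rw [Real.exp_add, Real.exp_log two_pos]; ring
    _ ≤ Real.exp (-(γ / 16 * m * N)) := by
        rw [Real.exp_le_exp]
        -- Since n ≥ 1, `k4` gives log 2 ≤ mγN/16, half of the available exponent.
        have := mul_le_mul_of_nonneg_left hn1 hl2.le
        linarith
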